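/- Let $(X,\rho)$ be a complete separable metric space and let $0<p<1$. Let $\mathcal W_p(X)$ be the set of Borel probability measures $\mu$ on $X$ with $\int_X \rho(x,\hat x)^p\,\mathrm d\mu(x)<\infty$ for some $\hat x\in X$, endowed with the $p$-Wasserstein distance $$d_{\mathcal W_p}(\mu,\nu)=\Bigl(\inf_{\pi\in\Pi(\mu,\nu)}\int_{X\times X}\rho(x,y)^p\,\mathrm d\pi(x,y)\Bigr)^{\min\{1/p,\,1\}},$$ where $\Pi(\mu,\nu)$ is the set of Borel probability measures on $X\times X$ with marginals $\mu$ and $\nu$ (for $0<p<1$ the exponent is $1$). An isometry of a metric space is a distance preserving bijection of the space onto itself. Then $\mathcal W_p(X)$ is isometrically rigid, that is, the push-forward map $\mathrm{Isom}(X)\to\mathrm{Isom}(\mathcal W_p(X))$, $\psi\mapsto\psi_\#$, where $(\psi_\#\mu)(A)=\mu(\psi^{-1}[A])$ for Borel sets $A\subseteq X$, is surjective: for every isometry $\Phi\colon\mathcal W_p(X)\to\mathcal W_p(X)$ there is an isometry $\psi\in\mathrm{Isom}(X)$ such that $$\Phi(\mu)=\psi_\#\mu\qquad\text{for all }\mu\in\mathcal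 W_p(X).$$ -/

import Mathlib

open MeasureTheory
open scoped ENNReal

namespace Wasserstein

/-- The set `Π(μ, ν)` of couplings (transport plans) of two measures: the probability measures on
`X × X` with first marginal `μ` and second marginal `ν`. -/
def couplings {X : Type*} [MeasurableSpace X] (μ ν : Measure X) : Set (Measure (X × X)) :=
  {π | IsProbabilityMeasure π ∧ π.fst = μ ∧ π.snd = ν}

/-- The underlying set of the `p`-Wasserstein space: Borel probability measures `μ` on `X` such
that `∫ ρ(x, x₀) ^ p dμ(x) < ∞` for some `x₀`. -/
def Space (p : ℝ) (X : Type*) [MetricSpace X] [MeasurableSpace X] : Type _ :=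
  {μ : ProbabilityMeasure X // ∃ x₀ : X, ∫⁻ x, edist x x₀ ^ p ∂(μ : Measure X) < ∞}

/-- The underlying measure of a point of the Wasserstein space. -/
def Space.toMeasure {p : ℝ} {X : Type*} [MetricSpace X] [MeasurableSpace X] (μ : Space p X) :
    Measure X :=
  (μ.1 : Measure X)

/-- The `p`-Wasserstein distance
`(inf_{π ∈ Π(μ, ν)} ∫ ρ(x, y) ^ p dπ(x, y)) ^ min (1 / p) 1`, as an extended nonnegative real
(it is finite on the `p`-Wasserstein space when `0 < p`). -/
noncomputable def wdist {p : ℝ} {X : Type*} [MetricSpace X] [MeasurableSpace X]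
    (μ ν : Space p X) : ℝ≥0∞ :=
  (⨅ π ∈ couplings μ.toMeasure ν.toMeasure, ∫⁻ z, edist z.1 z.2 ^ p ∂π) ^ min (1 / p) 1

/-- `Isom(W_p(X))`: the distance preserving bijections of the `p`-Wasserstein space. -/
structure Isom (p : ℝ) (X : Type*) [MetricSpace X] [MeasurableSpace X] extends
    Space p X ≃ Space p X where
  wdist_map : ∀ μ ν : Space p X, wdist (toFun μ) (toFun ν) = wdist μ ν

theorem Space.ext_measure {p : ℝ} {X : Type*} [MetricSpace X] [MeasurableSpace X]
    {μ ν : Space p X} (h : μ.toMeasure = ν.toMeasure) : μ = ν :=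
  Subtype.ext (Subtype.ext h)

section PushForward

variable {p : ℝ} {X : Type*} [MetricSpace X] [MeasurableSpace X] [BorelSpace X]

/-- The push-forward `ψ_# μ` of a point of `W_p(X)` by an isometry `ψ` of `X`. -/
noncomputable def pushSpace (ψ : X ≃ᵢ X) (μ : Space p X) : Space p X :=
  ⟨μ.1.map ψ.continuous.measurable.aemeasurable, by
    obtain ⟨x₀, h⟩ := μ.2
    refine ⟨ψ x₀, ?_⟩
    rw [ProbabilityMeasure.toMeasure_map]
    have e := lintegral_map_equiv (μ := (μ.1 : Measure X)) (fun x => edist x (ψ x₀) ^ p)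
      ψ.toHomeomorph.toMeasurableEquiv
    simp only [Homeomorph.toMeasurableEquiv_coe, IsometryEquiv.coe_toHomeomorph,
      ψ.isometry.edist_eq] at e
    rw [e]
    exact h⟩

theorem toMeasure_pushSpace (ψ : X ≃ᵢ X) (μ : Space p X) :
    (pushSpace ψ μ).toMeasure = μ.toMeasure.map ψ :=
  ProbabilityMeasure.toMeasure_map μ.1 ψ.continuous.measurable.aemeasurable

theorem pushSpace_symm_pushSpace (ψ : X ≃ᵢ X) (μ : Space p X) :
    pushSpace ψ.symm (pushSpace ψ μ) = μ := by
  apply Space.ext_measure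
  rw [toMeasure_pushSpace, toMeasure_pushSpace,
    Measure.map_map ψ.symm.continuous.measurable ψ.continuous.measurable]
  have : (ψ.symm ∘ ψ : X → X) = id := by ext x; simp
  rw [this, Measure.map_id]

theorem wdist_pushSpace_le (ψ : X ≃ᵢ X) (μ ν : Space p X) (hp : 0 ≤ min (1 / p) 1) :
    wdist (pushSpace ψ μ) (pushSpace ψ ν) ≤ wdist μ ν := by
  refine ENNReal.rpow_le_rpow ?_ hp
  refine le_iInf₂ fun π hπ => ?_
  obtain ⟨h0, h1, h2⟩ := hπ
  have hψ : Measurable ψ := ψ.continuous.measurable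
  let e : X ≃ᵐ X := ψ.toHomeomorph.toMeasurableEquiv
  have hm : Measurable (Prod.map ψ ψ) := hψ.prodMap hψ
  have hmem : π.map (Prod.map ψ ψ) ∈
      couplings (pushSpace ψ μ).toMeasure (pushSpace ψ ν).toMeasure := by
    refine ⟨?_, ?_, ?_⟩
    · exact Measure.isProbabilityMeasure_map hm.aemeasurable
    · rw [toMeasure_pushSpace, ← h1, Measure.fst, Measure.fst, Measure.map_map measurable_fst hm,
        Measure.map_map hψ measurable_fst]
      rfl
    · rw [toMeasure_pushSpace, ← h2, Measure.snd, Measure.snd, Measure.map_map measurable_snd hm,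
        Measure.map_map hψ measurable_snd]
      rfl
  refine (iInf₂_le (π.map (Prod.map ψ ψ)) hmem).trans ?_
  have h := lintegral_map_equiv (μ := π) (fun z => edist z.1 z.2 ^ p) (e.prodCongr e)
  have hc : (⇑(e.prodCongr e) : X × X → X × X) = Prod.map ψ ψ := rfl
  rw [hc] at h
  rw [h]
  simp only [Prod.map_fst, Prod.map_snd, ψ.isometry.edist_eq]
  exact le_rfl

theorem wdist_pushSpace (hp : 0 < p) (ψ : X ≃ᵢ X) (μ ν : Space p X) :
    wdist (pushSpace ψ μ) (pushSpace ψ ν) = wdist μ ν := by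
  have hm : 0 ≤ min (1 / p) 1 := by positivity
  refine le_antisymm (wdist_pushSpace_le ψ μ ν hm) ?_
  have h := wdist_pushSpace_le ψ.symm (pushSpace ψ μ) (pushSpace ψ ν) hm
  rwa [pushSpace_symm_pushSpace, pushSpace_symm_pushSpace] at h

/-- The push-forward map `# : Isom(X) → Isom(W_p(X))`, `ψ ↦ ψ_#`. -/
noncomputable def push (hp : 0 < p) (ψ : X ≃ᵢ X) : Isom p X where
  toFun := pushSpace ψ
  invFun := pushSpace ψ.symm
  left_inv := pushSpace_symm_pushSpace ψ
  right_inv := pushSpace_symm_pushSpace ψ.symm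
  wdist_map := wdist_pushSpace hp ψ

end PushForward

/-- `W_p(X)` is isometrically rigid: the push-forward map `Isom(X) → Isom(W_p(X))` is
surjective. -/
def IsometricallyRigid (p : ℝ) (hp : 0 < p) (X : Type*) [MetricSpace X] [MeasurableSpace X]
    [BorelSpace X] : Prop :=
  Function.Surjective (push hp : (X ≃ᵢ X) → Isom p X)

end Wasserstein

/-! For `0 < p < 1` the cost `ρ ^ p` is itself a metric, and its triangle inequality is strict:
equality holds only when the middle point is an endpoint (`eq_or_eq_of_cost_add_le`). This lets the
metric of the Wasserstein space recognise Dirac measures and atoms.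

A measure is Dirac exactly when it lies metrically between two measures only by equalling one of
them (`eq_or_eq_diracSpace_of_between`, `exists_eq_diracSpace`). An isometry `Φ` therefore permutes
the Dirac measures, and this permutation is an isometry `ψ` of `X`. After composition with the
push-forward by the inverse of `ψ`, all Dirac measures are fixed.

A measure carried by two points is determined by its distances to the two Dirac measures, hence is
fixed too. Testing `ν` against such measures shows that `Φ` decreases no atom
(`exists_two_points_between`, `singleton_le_of_two_points_between`). Hence measures with countable
support are fixed, and by density (`exists_countable_wdist_lt`, `eq_of_approx`) so is every measure.
-/

namespace Wasserstein

/-- The transport cost `ρ(x, y) ^ p`. -/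
noncomputable def cost (p : ℝ) {X : Type*} [MetricSpace X] (x y : X) : ℝ≥0∞ := edist x y ^ p

/-! ### The strict triangle inequality for the cost -/

section Cost

variable {p : ℝ} {X : Type*} [MetricSpace X]

theorem cost_ne_top (hp : 0 < p) (x y : X) : cost p x y ≠ ⊤ :=
  ENNReal.rpow_ne_top_of_nonneg hp.le (edist_ne_top x y)

theorem cost_self (hp : 0 < p) (x : X) : cost p x x = 0 := by
  simp [cost, hp]

theorem cost_comm (x y : X) : cost p x y = cost p y x := by
  rw [cost, cost, edist_comm]

theorem cost_eq_zero (hp : 0 < p) {x y : X} : cost p x y = 0 ↔ x = y := by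
  simp [cost, ENNReal.rpow_eq_zero_iff_of_pos hp]

theorem cost_triangle (hp0 : 0 < p) (hp1 : p < 1) (x y z : X) :
    cost p x z ≤ cost p x y + cost p y z :=
  (ENNReal.rpow_le_rpow (edist_triangle x y z) hp0.le).trans
    (ENNReal.rpow_add_le_add_rpow _ _ hp0.le hp1.le)

/-- Write `c ^ p = c * c ^ (p - 1)`; the second factor is strictly decreasing in `c`. -/
theorem _root_.Real.add_rpow_lt_rpow_add_rpow {a b p : ℝ} (ha : 0 < a) (hb : 0 < b)
    (hp1 : p < 1) : (a + b) ^ p < a ^ p + b ^ p := by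
  have key : ∀ {c : ℝ}, 0 < c → c ^ p = c * c ^ (p - 1) := fun {c} hc => by
    rw [Real.rpow_sub_one hc.ne', mul_div_cancel₀ _ hc.ne']
  have h1 : (a + b) ^ (p - 1) < a ^ (p - 1) :=
    Real.rpow_lt_rpow_of_neg ha (by linarith) (by linarith)
  have h2 : (a + b) ^ (p - 1) < b ^ (p - 1) :=
    Real.rpow_lt_rpow_of_neg hb (by linarith) (by linarith)
  rw [key ha, key hb, key (add_pos ha hb), add_mul]
  gcongr

/-- Strict subadditivity of `t ^ p` excludes proper intermediate points. For `p = 1` this fails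
already on the real line. -/
theorem eq_or_eq_of_cost_add_le (hp0 : 0 < p) (hp1 : p < 1) {x y z : X}
    (h : cost p x y + cost p y z ≤ cost p x z) : y = x ∨ y = z := by
  by_contra! hne
  have hx : 0 < dist x y := dist_pos.2 hne.1.symm
  have hz : 0 < dist y z := dist_pos.2 hne.2
  have hlt := Real.add_rpow_lt_rpow_add_rpow hx hz hp1
  have hle : dist x z ^ p ≤ (dist x y + dist y z) ^ p :=
    Real.rpow_le_rpow dist_nonneg (dist_triangle x y z) hp0.le
  simp only [cost, edist_dist, ENNReal.ofReal_rpow_of_nonneg dist_nonneg hp0.le] at h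
  rw [← ENNReal.ofReal_add (by positivity) (by positivity),
    ENNReal.ofReal_le_ofReal_iff (by positivity)] at h
  linarith

end Cost

/-! ### Marginals of plans -/

section Marginals

variable {X : Type*} [MeasurableSpace X]

theorem lintegral_fst {π : Measure (X × X)} {μ : Measure X} (h : π.fst = μ) {f : X → ℝ≥0∞}
    (hf : Measurable f) : ∫⁻ z, f z.1 ∂π = ∫⁻ x, f x ∂μ := by
  rw [← h, Measure.fst, lintegral_map hf measurable_fst]

theorem lintegral_snd {π : Measure (X × X)} {μ : Measure X} (h : π.snd = μ) {f : X → ℝ≥0∞}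
    (hf : Measurable f) : ∫⁻ z, f z.2 ∂π = ∫⁻ x, f x ∂μ := by
  rw [← h, Measure.snd, lintegral_map hf measurable_snd]

theorem fst_map_diag (μ : Measure X) : (μ.map fun z => (z, z)).fst = μ := by
  rw [Measure.fst_map_prodMk measurable_id', Measure.map_id']

theorem snd_map_diag (μ : Measure X) : (μ.map fun z => (z, z)).snd = μ := by
  rw [Measure.snd_map_prodMk measurable_id', Measure.map_id']

theorem fst_smul (c : ℝ≥0∞) (π : Measure (X × X)) : (c • π).fst = c • π.fst :=
  Measure.map_smul c π Prod.fst

theorem snd_smul (c : ℝ≥0∞) (π : Measure (X × X)) : (c • π).snd = c • π.snd :=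
  Measure.map_smul c π Prod.snd

theorem eq_dirac_of_measure_compl [MeasurableSingletonClass X] {μ : Measure X} [IsProbabilityMeasure μ] {x : X}
    (h : μ {x}ᶜ = 0) : μ = Measure.dirac x := by
  have h' : id =ᵐ[μ] fun _ => x := by
    filter_upwards [compl_mem_ae_iff.2 h] with z hz
    simpa using hz
  rw [← Measure.map_id (μ := μ), Measure.map_congr h', Measure.map_const, measure_univ, one_smul]

end Marginals

/-! ### Couplings, transport maps and distances to Dirac measures -/

section Distance

variable {p : ℝ} {X : Type*} [MetricSpace X] [MeasurableSpace X]

instance (μ : Space p X) : IsProbabilityMeasure μ.toMeasure :=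
  inferInstanceAs (IsProbabilityMeasure (μ.1 : Measure X))

theorem wdist_eq_iInf (hp0 : 0 < p) (hp1 : p < 1) (μ ν : Space p X) :
    wdist μ ν = ⨅ π ∈ couplings μ.toMeasure ν.toMeasure, ∫⁻ z, cost p z.1 z.2 ∂π := by
  have h : min (1 / p) 1 = 1 := min_eq_right ((one_le_div hp0).2 hp1.le)
  rw [wdist, h, ENNReal.rpow_one]
  rfl

theorem exists_eq_cond (μ : Space p X) {A : Set X} (hA : μ.toMeasure A ≠ 0) :
    ∃ α : Space p X, α.toMeasure = ProbabilityTheory.cond μ.toMeasure A := by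
  obtain ⟨x₀, h⟩ := μ.2
  have hprob : IsProbabilityMeasure (ProbabilityTheory.cond μ.toMeasure A) :=
    ProbabilityTheory.cond_isProbabilityMeasure hA
  refine ⟨⟨⟨_, hprob⟩, x₀, ?_⟩, rfl⟩
  change ∫⁻ x, edist x x₀ ^ p ∂(ProbabilityTheory.cond μ.toMeasure A) < ∞
  rw [ProbabilityTheory.cond, lintegral_smul_measure]
  exact ENNReal.mul_lt_top (ENNReal.inv_lt_top.2 (pos_iff_ne_zero.2 hA))
    ((setLIntegral_le_lintegral _ _).trans_lt h)

theorem lintegral_cost_ne_top (hp0 : 0 < p) (hp1 : p < 1) (μ : Space p X) (x : X) :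
    ∫⁻ z, cost p x z ∂μ.toMeasure ≠ ⊤ := by
  obtain ⟨x₀, h⟩ := μ.2
  have h' : ∫⁻ z, cost p x₀ z ∂μ.toMeasure < ⊤ := by
    simp only [cost, edist_comm x₀]
    exact h
  refine ne_top_of_le_ne_top ?_ (lintegral_mono fun z => cost_triangle hp0 hp1 x x₀ z)
  rw [lintegral_add_left measurable_const]
  simp [cost_ne_top hp0, h'.ne]

theorem wdist_le_of_coupling (hp0 : 0 < p) (hp1 : p < 1) {μ ν : Space p X} {π : Measure (X × X)}
    (h1 : π.fst = μ.toMeasure) (h2 : π.snd = ν.toMeasure) :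
    wdist μ ν ≤ ∫⁻ z, cost p z.1 z.2 ∂π := by
  rw [wdist_eq_iInf hp0 hp1]
  refine iInf₂_le π ⟨⟨?_⟩, h1, h2⟩
  rw [← Measure.fst_univ, h1, measure_univ]

theorem exists_coupling_of_wdist_lt (hp0 : 0 < p) (hp1 : p < 1) {μ ν : Space p X} {r : ℝ≥0∞}
    (h : wdist μ ν < r) : ∃ π : Measure (X × X), π.fst = μ.toMeasure ∧ π.snd = ν.toMeasure ∧
      ∫⁻ z, cost p z.1 z.2 ∂π < r := by
  rw [wdist_eq_iInf hp0 hp1] at h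
  simp only [iInf_lt_iff] at h
  obtain ⟨π, hπ, hr⟩ := h
  exact ⟨π, hπ.2.1, hπ.2.2, hr⟩

variable [BorelSpace X] [SecondCountableTopology X]

theorem measurable_cost {Y : Type*} [MeasurableSpace Y] {f g : Y → X} (hf : Measurable f)
    (hg : Measurable g) : Measurable fun y => cost p (f y) (g y) :=
  (hf.edist hg).pow_const p

theorem wdist_comm (hp0 : 0 < p) (hp1 : p < 1) (μ ν : Space p X) : wdist μ ν = wdist ν μ := by
  have key : ∀ μ ν : Space p X, wdist μ ν ≤ wdist ν μ := fun μ ν => by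
    rw [wdist_eq_iInf hp0 hp1 ν μ]
    refine le_iInf₂ fun π hπ => ?_
    have h := wdist_le_of_coupling hp0 hp1 (μ := μ) (ν := ν) (π := π.map Prod.swap)
      (by rw [Measure.fst_map_swap, hπ.2.2]) (by rw [Measure.snd_map_swap, hπ.2.1])
    rw [lintegral_map (measurable_cost measurable_fst measurable_snd) measurable_swap] at h
    simpa only [Prod.fst_swap, Prod.snd_swap, cost_comm] using h
  exact le_antisymm (key μ ν) (key ν μ)

/-- A transport map of finite cost sends a point of the Wasserstein space to another one, and its
cost bounds their distance. -/
theorem exists_eq_map (hp0 : 0 < p) (hp1 : p < 1) (μ : Space p X) {T : X → X}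
    (hT : Measurable T) (h : ∫⁻ z, cost p z (T z) ∂μ.toMeasure ≠ ⊤) :
    ∃ ν : Space p X, ν.toMeasure = μ.toMeasure.map T ∧
      wdist μ ν ≤ ∫⁻ z, cost p z (T z) ∂μ.toMeasure := by
  obtain ⟨x₀, -⟩ := μ.2
  have hfin : ∫⁻ x, edist x x₀ ^ p ∂(μ.toMeasure.map T) < ∞ := by
    change ∫⁻ x, cost p x x₀ ∂(μ.toMeasure.map T) < ∞
    rw [lintegral_map (measurable_cost measurable_id' measurable_const) hT]
    refine lt_of_le_of_lt (lintegral_mono fun z => ?_)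
      (ENNReal.add_lt_top.2 ⟨h.lt_top, (lintegral_cost_ne_top hp0 hp1 μ x₀).lt_top⟩ |>.trans_le'
        (lintegral_add_left (measurable_cost measurable_id' hT) _).le)
    rw [cost_comm z, cost_comm x₀]
    exact cost_triangle hp0 hp1 _ _ _
  have : IsProbabilityMeasure (μ.toMeasure.map T) :=
    Measure.isProbabilityMeasure_map hT.aemeasurable
  refine ⟨⟨⟨μ.toMeasure.map T, this⟩, x₀, hfin⟩, rfl, ?_⟩
  refine (wdist_le_of_coupling hp0 hp1 (π := μ.toMeasure.map fun z => (z, T z)) ?_ ?_).trans ?_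
  · rw [Measure.fst_map_prodMk hT, Measure.map_id']
  · rw [Measure.snd_map_prodMk measurable_id']; rfl
  · rw [lintegral_map (measurable_cost measurable_fst measurable_snd) (measurable_id'.prodMk hT)]

/-- The Dirac measure at `x` as a point of the Wasserstein space. -/
noncomputable def diracSpace (hp : 0 < p) (x : X) : Space p X :=
  ⟨diracProba x, x, by
    change ∫⁻ z, edist z x ^ p ∂(Measure.dirac x) < ∞
    simp [hp]⟩

theorem toMeasure_diracSpace (hp : 0 < p) (x : X) :
    (diracSpace hp x).toMeasure = Measure.dirac x := rfl

/-- A coupling with first marginal `Measure.dirac x` is concentrated on `{x} × X`, so all couplings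
have the same cost. -/
theorem wdist_diracSpace (hp0 : 0 < p) (hp1 : p < 1) (x : X) (μ : Space p X) :
    wdist (diracSpace hp0 x) μ = ∫⁻ z, cost p x z ∂μ.toMeasure := by
  have key : ∀ π : Measure (X × X), π.fst = Measure.dirac x → π.snd = μ.toMeasure →
      ∫⁻ z, cost p z.1 z.2 ∂π = ∫⁻ z, cost p x z ∂μ.toMeasure := fun π h1 h2 => by
    rw [← lintegral_snd h2 (measurable_cost measurable_const measurable_id')]
    refine lintegral_congr_ae ?_
    have h0 : π (Prod.fst ⁻¹' {x}ᶜ) = 0 := by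
      rw [← Measure.fst_apply (measurableSet_singleton x).compl, h1]
      simp
    filter_upwards [compl_mem_ae_iff.2 h0] with z hz
    rw [show z.1 = x by simpa using hz]
  refine le_antisymm ?_ ?_
  · rw [← key ((Measure.dirac x).prod μ.toMeasure) Measure.fst_prod Measure.snd_prod]
    exact wdist_le_of_coupling hp0 hp1 Measure.fst_prod Measure.snd_prod
  · rw [wdist_eq_iInf hp0 hp1]
    exact le_iInf₂ fun π hπ => (key π hπ.2.1 hπ.2.2).ge

theorem wdist_diracSpace_right (hp0 : 0 < p) (hp1 : p < 1) (x : X) (μ : Space p X) :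
    wdist μ (diracSpace hp0 x) = ∫⁻ z, cost p x z ∂μ.toMeasure := by
  rw [wdist_comm hp0 hp1, wdist_diracSpace hp0 hp1]

theorem wdist_diracSpace_diracSpace (hp0 : 0 < p) (hp1 : p < 1) (x y : X) :
    wdist (diracSpace hp0 x) (diracSpace hp0 y) = cost p x y := by
  rw [wdist_diracSpace hp0 hp1, toMeasure_diracSpace, lintegral_dirac]

end Distance

/-! ### Metric characterisation of Dirac measures -/

section Dirac

variable {p : ℝ} {X : Type*} [MetricSpace X] [MeasurableSpace X] [BorelSpace X]
  [SecondCountableTopology X]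

/-- The hypothesis forces equality almost everywhere in the triangle inequality through `x`, even
for the product coupling. Strictness makes `{x}ᶜ ×ˢ {x}ᶜ` null, and for a product measure this means
that one factor vanishes off `x`. -/
theorem eq_or_eq_diracSpace_of_between (hp0 : 0 < p) (hp1 : p < 1) {x : X} {μ ν : Space p X}
    (h : wdist μ (diracSpace hp0 x) + wdist (diracSpace hp0 x) ν ≤ wdist μ ν) :
    μ = diracSpace hp0 x ∨ ν = diracSpace hp0 x := by
  have hm : Measurable fun z => cost p x z := measurable_cost measurable_const measurable_id'
  have hm1 : Measurable fun z : X × X => cost p x z.1 := hm.comp measurable_fst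
  have hm2 : Measurable fun z : X × X => cost p x z.2 := hm.comp measurable_snd
  set π := μ.toMeasure.prod ν.toMeasure with hπ
  have hsum : ∫⁻ z, (cost p x z.1 + cost p x z.2) ∂π =
      wdist μ (diracSpace hp0 x) + wdist (diracSpace hp0 x) ν := by
    rw [lintegral_add_left hm1, lintegral_fst Measure.fst_prod hm,
      lintegral_snd Measure.snd_prod hm, wdist_diracSpace hp0 hp1, wdist_diracSpace_right hp0 hp1]
  have hfin : wdist μ (diracSpace hp0 x) + wdist (diracSpace hp0 x) ν ≠ ⊤ := by
    rw [wdist_diracSpace hp0 hp1, wdist_diracSpace_right hp0 hp1]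
    exact ENNReal.add_ne_top.2 ⟨lintegral_cost_ne_top hp0 hp1 μ x,
      lintegral_cost_ne_top hp0 hp1 ν x⟩
  have htri : ∀ z : X × X, cost p z.1 z.2 ≤ cost p x z.1 + cost p x z.2 := fun z => by
    rw [cost_comm x z.1]; exact cost_triangle hp0 hp1 _ _ _
  have hae := ae_eq_of_ae_le_of_lintegral_le (μ := π) (f := fun z => cost p z.1 z.2)
    (g := fun z => cost p x z.1 + cost p x z.2) (Filter.Eventually.of_forall htri)
    (ne_top_of_le_ne_top (hsum ▸ hfin) (lintegral_mono htri)) (hm1.add hm2).aemeasurable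
    (hsum.le.trans (h.trans (wdist_le_of_coupling hp0 hp1 Measure.fst_prod Measure.snd_prod)))
  have h0 : π ({x}ᶜ ×ˢ {x}ᶜ) = 0 := by
    refine measure_mono_null (t := {z | ¬ cost p z.1 z.2 = cost p x z.1 + cost p x z.2})
      (fun z hz (hz' : cost p z.1 z.2 = cost p x z.1 + cost p x z.2) => ?_) hae
    have hz'' : cost p z.1 x + cost p x z.2 ≤ cost p z.1 z.2 := by
      rw [cost_comm z.1 x]; exact hz'.ge
    rcases eq_or_eq_of_cost_add_le hp0 hp1 hz'' with h | h
    · exact hz.1 h.symm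
    · exact hz.2 h.symm
  rw [hπ, Measure.prod_prod, mul_eq_zero] at h0
  exact h0.imp (fun h => Space.ext_measure (eq_dirac_of_measure_compl h))
    (fun h => Space.ext_measure (eq_dirac_of_measure_compl h))

theorem lintegral_cost_map_diag (hp0 : 0 < p) (μ : Measure X) :
    ∫⁻ z, cost p z.1 z.2 ∂(μ.map fun z => (z, z)) = 0 := by
  rw [lintegral_map (measurable_cost measurable_fst measurable_snd)
    (measurable_id'.prodMk measurable_id')]
  simp [cost_self hp0]

/-- A convex combination of `α` and `β` lies metrically between them. -/
theorem between_of_convex_combination (hp0 : 0 < p) (hp1 : p < 1) {α β μ : Space p X}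
    {s t : ℝ≥0∞} (hst : s + t = 1)
    (hμ : μ.toMeasure = s • α.toMeasure + t • β.toMeasure) :
    wdist α μ + wdist μ β ≤ wdist α β := by
  rw [wdist_eq_iInf hp0 hp1 α β]
  refine le_iInf₂ fun π ⟨_, h1, h2⟩ => ?_
  -- Leave the fraction `s` of `α` in place and transport the rest along `π`.
  have e1 : wdist α μ ≤ t * ∫⁻ z, cost p z.1 z.2 ∂π := by
    refine (wdist_le_of_coupling hp0 hp1
      (π := s • (α.toMeasure.map fun z => (z, z)) + t • π) ?_ ?_).trans_eq ?_
    · rw [Measure.fst_add, fst_smul, fst_smul, fst_map_diag, h1, ← add_smul, hst,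
        one_smul]
    · rw [Measure.snd_add, snd_smul, snd_smul, snd_map_diag, h2, hμ]
    · rw [lintegral_add_measure, lintegral_smul_measure, lintegral_smul_measure,
        lintegral_cost_map_diag hp0, smul_zero, zero_add, smul_eq_mul]
  have e2 : wdist μ β ≤ s * ∫⁻ z, cost p z.1 z.2 ∂π := by
    refine (wdist_le_of_coupling hp0 hp1
      (π := s • π + t • (β.toMeasure.map fun z => (z, z))) ?_ ?_).trans_eq ?_
    · rw [Measure.fst_add, fst_smul, fst_smul, fst_map_diag, h1, hμ]
    · rw [Measure.snd_add, snd_smul, snd_smul, snd_map_diag, h2, ← add_smul, hst,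
        one_smul]
    · rw [lintegral_add_measure, lintegral_smul_measure, lintegral_smul_measure,
        lintegral_cost_map_diag hp0, smul_zero, add_zero, smul_eq_mul]
  refine (add_le_add e1 e2).trans_eq ?_
  rw [← add_mul, add_comm t, hst, one_mul]

/-- If some `A` had measure strictly between 0 and 1, `μ` would lie between its conditionings on `A`
and `Aᶜ`, both different from `μ`. So `μ` takes only the values 0 and 1, hence is Dirac as `X` is
complete and separable. -/
theorem exists_eq_diracSpace [CompleteSpace X] (hp0 : 0 < p) (hp1 : p < 1) {μ : Space p X}
    (h : ∀ α β : Space p X, wdist α μ + wdist μ β ≤ wdist α β → α = μ ∨ β = μ) :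
    ∃ x, μ = diracSpace hp0 x := by
  have : IsZeroOneMeasure μ.toMeasure := by
    refine ⟨fun {A} hA => ?_⟩
    by_contra! hne
    have hc : μ.toMeasure Aᶜ ≠ 0 := fun h0 =>
      hne.2 ((prob_compl_eq_zero_iff hA).1 h0)
    obtain ⟨α, hα⟩ := exists_eq_cond μ hne.1
    obtain ⟨β, hβ⟩ := exists_eq_cond μ hc
    have hb := between_of_convex_combination hp0 hp1 (α := α) (β := β) (μ := μ)
      (prob_add_prob_compl hA) (by
        ext B hB
        rw [hα, hβ]
        simp only [Measure.add_apply, Measure.smul_apply, smul_eq_mul]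
        rw [mul_comm, mul_comm (μ.toMeasure Aᶜ), ProbabilityTheory.cond_mul_eq_inter hA,
          ProbabilityTheory.cond_mul_eq_inter hA.compl, Set.inter_comm, Set.inter_comm Aᶜ,
          ← Set.sdiff_eq, measure_inter_add_sdiff _ hA])
    rcases h α β hb with h | h
    · rw [h] at hα
      exact hne.2 (by rw [hα, ProbabilityTheory.cond_apply_self hne.1 (measure_ne_top _ _)])
    · rw [h] at hβ
      refine hne.1 ((prob_compl_eq_one_iff hA).1 ?_)
      rw [hβ, ProbabilityTheory.cond_apply_self hc (measure_ne_top _ _)]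
  obtain ⟨x, hx⟩ := IsZeroOneMeasure.exists_eq_dirac (μ := μ.toMeasure)
  exact ⟨x, Space.ext_measure hx⟩

end Dirac

/-! ### Detecting atoms by two-point measures -/

section Atoms

/-- One-sided control of atoms suffices: it gives `μ ≤ ν`, and the total masses agree. -/
theorem eq_of_forall_singleton_le {X : Type*} [MeasurableSpace X] [MeasurableSingletonClass X]
    {μ ν : Measure X} [IsProbabilityMeasure μ] [IsProbabilityMeasure ν] {S : Set X}
    (hS : S.Countable) (h0 : μ Sᶜ = 0) (h : ∀ x ∈ S, μ {x} ≤ ν {x}) : μ = ν := by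
  refine Measure.eq_of_le_of_isProbabilityMeasure (Measure.le_iff.2 fun A _ => ?_)
  have hc : (A ∩ S).Countable := hS.mono Set.inter_subset_right
  have key : ∀ m : Measure X, m (A ∩ S) = ∑' x : ↥(A ∩ S), m {(x : X)} := fun m => by
    rw [← measure_biUnion hc (fun x _ y _ hxy => Set.disjoint_singleton.2 hxy)
      fun x _ => measurableSet_singleton x, Set.biUnion_of_singleton]
  calc μ A ≤ μ (A ∩ S) + μ Sᶜ := (measure_mono fun x hx => by
          by_cases h : x ∈ S
          · exact Or.inl ⟨hx, h⟩
          · exact Or.inr h).trans (measure_union_le _ _)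
    _ = ∑' x : ↥(A ∩ S), μ {(x : X)} := by rw [h0, add_zero, key]
    _ ≤ ∑' x : ↥(A ∩ S), ν {(x : X)} := ENNReal.tsum_le_tsum fun x => h x x.2.2
    _ ≤ ν A := by rw [← key]; exact measure_mono Set.inter_subset_left

variable {p : ℝ} {X : Type*} [MetricSpace X] [MeasurableSpace X] [BorelSpace X]

theorem lintegral_cost_of_two_points (hp0 : 0 < p) {x y : X} {μ : Measure X}
    (h : μ {x, y}ᶜ = 0) : ∫⁻ z, cost p x z ∂μ = μ {y} * cost p x y := by
  have hae : (fun z => cost p x z) =ᵐ[μ] Set.indicator {y} fun _ => cost p x y := by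
    filter_upwards [compl_mem_ae_iff.2 h] with z hz
    by_cases hzy : z = y
    · rw [hzy, Set.indicator_of_mem (Set.mem_singleton y)]
    · have hzx : z = x := by simpa [hzy] using hz
      rw [Set.indicator_of_notMem (by simpa using hzy), hzx, cost_self hp0]
  rw [lintegral_congr_ae hae, lintegral_indicator_const (measurableSet_singleton y), mul_comm]

variable [SecondCountableTopology X]

/-- Two-point measures are determined by their distances to the two Dirac measures. -/
theorem eq_of_wdist_eq_of_two_points (hp0 : 0 < p) (hp1 : p < 1) {x y : X} (hxy : x ≠ y)
    {η ν : Space p X} (hη : η.toMeasure {x, y}ᶜ = 0)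
    (hx : wdist (diracSpace hp0 x) ν = wdist (diracSpace hp0 x) η)
    (hy : wdist (diracSpace hp0 y) ν = wdist (diracSpace hp0 y) η) : η = ν := by
  simp only [wdist_diracSpace hp0 hp1] at hx hy
  have hm : ∀ w : X, Measurable fun z => cost p w z := fun w =>
    measurable_cost measurable_const measurable_id'
  have hη' : η.toMeasure {y, x}ᶜ = 0 := by rwa [Set.pair_comm]
  -- The two distances add up to the minimum possible, `cost p x y`, so strictness confines `ν` to
  -- `{x, y}`; each distance then reads off one weight.
  have hsum : ∫⁻ z, (cost p x z + cost p y z) ∂ν.toMeasure = ∫⁻ _, cost p x y ∂ν.toMeasure := by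
    rw [lintegral_add_left (hm x), hx, hy, ← lintegral_add_left (hm x), lintegral_const,
      measure_univ, ← measure_univ (μ := η.toMeasure), ← lintegral_const]
    refine lintegral_congr_ae ?_
    filter_upwards [compl_mem_ae_iff.2 hη] with z hz
    have hz' : z = x ∨ z = y := by simpa using hz
    rcases hz' with rfl | rfl
    · rw [cost_self hp0, zero_add, cost_comm]
    · rw [cost_self hp0, add_zero]
  have htri : ∀ z, cost p x y ≤ cost p x z + cost p y z := fun z => by
    rw [cost_comm y]; exact cost_triangle hp0 hp1 _ _ _
  have hae := ae_eq_of_ae_le_of_lintegral_le (Filter.Eventually.of_forall htri)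
    (by simp [cost_ne_top hp0]) ((hm x).add (hm y)).aemeasurable hsum.le
  have hν : ν.toMeasure {x, y}ᶜ = 0 := by
    rw [← compl_mem_ae_iff, compl_compl]
    filter_upwards [hae] with z hz
    exact eq_or_eq_of_cost_add_le hp0 hp1 (by rw [cost_comm z]; exact hz.ge)
  have hν' : ν.toMeasure {y, x}ᶜ = 0 := by rwa [Set.pair_comm]
  rw [lintegral_cost_of_two_points hp0 hν, lintegral_cost_of_two_points hp0 hη] at hx
  rw [lintegral_cost_of_two_points hp0 hν', lintegral_cost_of_two_points hp0 hη'] at hy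
  have hc : ∀ {a b : X}, a ≠ b → cost p a b ≠ 0 := fun h h0 => h ((cost_eq_zero hp0).1 h0)
  refine Space.ext_measure (eq_of_forall_singleton_le (Set.toFinite {x, y}).countable hη ?_)
  rintro z (rfl | rfl)
  · exact ((ENNReal.mul_left_inj (hc hxy.symm) (cost_ne_top hp0 _ _)).1 hy).ge
  · exact ((ENNReal.mul_left_inj (hc hxy) (cost_ne_top hp0 _ _)).1 hx).ge

/-- Collapse everything except `y` to `x`. Compared with collapsing all of `μ` to `x`, this saves
exactly the cost of moving the atom at `y`. -/
theorem exists_two_points_between (hp0 : 0 < p) (hp1 : p < 1) {x y : X} (hxy : x ≠ y)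
    (μ : Space p X) : ∃ η : Space p X, η.toMeasure {x, y}ᶜ = 0 ∧
      η.toMeasure {y} = μ.toMeasure {y} ∧
      wdist μ η + μ.toMeasure {y} * cost p x y ≤ wdist μ (diracSpace hp0 x) := by
  classical
  let T : X → X := fun z => if z = y then y else x
  have hT : Measurable T :=
    Measurable.ite (measurableSet_singleton y) measurable_const measurable_const
  have hpt : ∀ z, cost p z (T z) + Set.indicator {y} (fun _ => cost p x y) z = cost p x z := by
    intro z
    by_cases hz : z = y
    · simp [T, hz, cost_self hp0]
    · simp [T, hz, cost_comm]
  have hint : ∫⁻ z, cost p z (T z) ∂μ.toMeasure + μ.toMeasure {y} * cost p x y =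
      wdist μ (diracSpace hp0 x) := by
    rw [wdist_diracSpace_right hp0 hp1, ← lintegral_congr hpt,
      lintegral_add_left (measurable_cost measurable_id' hT),
      lintegral_indicator_const (measurableSet_singleton y), mul_comm]
  have hfin : ∫⁻ z, cost p z (T z) ∂μ.toMeasure ≠ ⊤ := by
    refine ne_top_of_le_ne_top ?_ (le_self_add.trans hint.le)
    rw [wdist_diracSpace_right hp0 hp1]
    exact lintegral_cost_ne_top hp0 hp1 μ x
  obtain ⟨η, hη, hle⟩ := exists_eq_map hp0 hp1 μ hT hfin
  refine ⟨η, ?_, ?_, ?_⟩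
  · have : T ⁻¹' {x, y}ᶜ = ∅ := by
      ext z
      by_cases hz : z = y <;> simp [T, hz]
    rw [hη, Measure.map_apply hT (Set.toFinite _).measurableSet.compl, this, measure_empty]
  · have : T ⁻¹' {y} = {y} := by
      ext z
      by_cases hz : z = y <;> simp [T, hz, hxy]
    rw [hη, Measure.map_apply hT (measurableSet_singleton y), this]
  · rw [← hint]
    gcongr

/-- The function `g` is the defect in the triangle inequality from `x` to `w` through `y`, and
vanishes only at `w = y`. The hypothesis makes its integral over the mass sent to `y` at most `τ`
for a plan within `τ` of optimal. Markov's inequality, then `τ → 0` and `δ → 0`, show that this mass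
is bounded by the atom of `ν` at `y`. -/
theorem singleton_le_of_two_points_between (hp0 : 0 < p) (hp1 : p < 1) {x y : X} (hxy : x ≠ y)
    {ν η : Space p X} (hη : η.toMeasure {x, y}ᶜ = 0)
    (h : wdist ν η + η.toMeasure {y} * cost p x y ≤ wdist ν (diracSpace hp0 x)) :
    η.toMeasure {y} ≤ ν.toMeasure {y} := by
  let g : X → ℝ≥0∞ := fun w => cost p w y + cost p x y - cost p x w
  have hm : Measurable fun w => cost p x w := measurable_cost measurable_const measurable_id'
  have hg : Measurable g :=
    ((measurable_cost measurable_id' measurable_const).add_const _).sub hm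
  have hg_add : ∀ w, cost p x w + g w = cost p w y + cost p x y := fun w => by
    refine add_tsub_cancel_of_le ?_
    rw [add_comm, cost_comm w]
    exact cost_triangle hp0 hp1 x y w
  have hg_zero : ∀ w, g w = 0 → w = y := fun w hw => by
    have := hg_add w
    rw [hw, add_zero] at this
    rcases eq_or_eq_of_cost_add_le hp0 hp1 (x := x) (y := y) (z := w)
      (by rw [this, add_comm, cost_comm w]) with h | h
    · exact absurd h.symm hxy
    · exact h.symm
  have hfin : wdist ν (diracSpace hp0 x) ≠ ⊤ := by
    rw [wdist_diracSpace_right hp0 hp1]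
    exact lintegral_cost_ne_top hp0 hp1 ν x
  -- the mass transported to `y` comes almost entirely from where `g` is small
  have hbound : ∀ δ τ : ℝ≥0∞, δ ≠ 0 → δ ≠ ⊤ → τ ≠ 0 →
      η.toMeasure {y} ≤ ν.toMeasure {w | g w < δ} + τ / δ := by
    intro δ τ hδ hδt hτ
    obtain ⟨π, h1, h2, hπ⟩ := exists_coupling_of_wdist_lt hp0 hp1 (μ := ν) (ν := η)
      (r := wdist ν η + τ) (ENNReal.lt_add_right
        (ne_top_of_le_ne_top hfin (le_self_add.trans h)) hτ)
    let E : Set (X × X) := Prod.snd ⁻¹' {y}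
    have hE : MeasurableSet E := measurable_snd (measurableSet_singleton y)
    have hπE : π E = η.toMeasure {y} := by
      rw [← h2, Measure.snd_apply (measurableSet_singleton y)]
    -- All mass arrives at `x` or `y`: on arrival at `y` this is the definition of `g`, on arrival
    -- at `x` it is symmetry of the cost.
    have hae : (fun z : X × X => cost p x z.1 + E.indicator (fun z => g z.1) z) =ᵐ[π]
        fun z => cost p z.1 z.2 + E.indicator (fun _ => cost p x y) z := by
      have h0 : π (Prod.snd ⁻¹' {x, y}ᶜ) = 0 := by
        rw [← Measure.snd_apply (Set.toFinite _).measurableSet.compl, h2, hη]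
      filter_upwards [compl_mem_ae_iff.2 h0] with z hz
      have hz' : z.2 = x ∨ z.2 = y := by simpa using hz
      by_cases hzy : z.2 = y
      · have hzE : z ∈ E := hzy
        rw [Set.indicator_of_mem hzE, Set.indicator_of_mem hzE, hzy, hg_add]
      · have hzE : z ∉ E := hzy
        rw [Set.indicator_of_notMem hzE, Set.indicator_of_notMem hzE, hz'.resolve_right hzy,
          cost_comm]
    have hint := lintegral_congr_ae hae
    have hm1 : Measurable fun z : X × X => cost p x z.1 := hm.comp measurable_fst
    rw [lintegral_add_left hm1, lintegral_fst h1 hm,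
      ← wdist_diracSpace_right hp0 hp1 x ν,
      lintegral_add_left (measurable_cost measurable_fst measurable_snd),
      lintegral_indicator_const hE, hπE, lintegral_indicator hE] at hint
    have hτ' : ∫⁻ z in E, g z.1 ∂π ≤ τ := by
      refine (ENNReal.add_le_add_iff_left hfin).1 ?_
      calc _ = _ := hint
        _ ≤ wdist ν η + τ + cost p x y * η.toMeasure {y} := by gcongr
        _ = wdist ν η + η.toMeasure {y} * cost p x y + τ := by ring
        _ ≤ _ := by gcongr
    have hmark : π (E ∩ {z | δ ≤ g z.1}) ≤ τ / δ := by
      rw [ENNReal.le_div_iff_mul_le (Or.inl hδ) (Or.inl hδt), mul_comm]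
      have := mul_meas_ge_le_lintegral (μ := π.restrict E) (hg.comp measurable_fst) δ
      rw [Measure.restrict_apply (measurableSet_le measurable_const (hg.comp measurable_fst)),
        Set.inter_comm] at this
      exact this.trans hτ'
    calc η.toMeasure {y} = π E := hπE.symm
      _ ≤ π (Prod.fst ⁻¹' {w | g w < δ} ∪ E ∩ {z | δ ≤ g z.1}) := measure_mono fun z hz => by
          rcases lt_or_ge (g z.1) δ with h | h
          · exact Or.inl h
          · exact Or.inr ⟨hz, h⟩
      _ ≤ π (Prod.fst ⁻¹' {w | g w < δ}) + π (E ∩ {z | δ ≤ g z.1}) := measure_union_le _ _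
      _ ≤ _ := by
          rw [← Measure.fst_apply (measurableSet_lt hg measurable_const), h1]
          gcongr
  -- The shift to `n + 1` keeps the threshold finite, since `0⁻¹ = ⊤`.
  let A : ℕ → Set X := fun n => {w | g w < ((n + 1 : ℕ) : ℝ≥0∞)⁻¹}
  have hbound' : ∀ n : ℕ, η.toMeasure {y} ≤ ν.toMeasure (A n) := by
    intro n
    have h0 : ((n + 1 : ℕ) : ℝ≥0∞)⁻¹ ≠ 0 := ENNReal.inv_ne_zero.2 (ENNReal.natCast_ne_top _)
    have ht : ((n + 1 : ℕ) : ℝ≥0∞)⁻¹ ≠ ⊤ := ENNReal.inv_ne_top.2 (by simp)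
    refine ENNReal.le_of_forall_pos_le_add fun ε hε _ => ?_
    have := hbound _ (ε * ((n + 1 : ℕ) : ℝ≥0∞)⁻¹) h0 ht
      (mul_ne_zero (ENNReal.coe_ne_zero.2 hε.ne') h0)
    rwa [ENNReal.mul_div_cancel_right h0 ht] at this
  have hanti : Antitone A := fun m n hmn w (hw : g w < _) =>
    lt_of_lt_of_le hw (ENNReal.inv_le_inv.2 (Nat.cast_le.2 (Nat.succ_le_succ hmn)))
  have hlim := tendsto_measure_iInter_atTop (μ := ν.toMeasure)
    (fun n => (measurableSet_lt hg measurable_const).nullMeasurableSet) hanti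
    ⟨0, measure_ne_top _ _⟩
  refine (ge_of_tendsto' hlim hbound').trans (measure_mono fun w hw => hg_zero w ?_)
  by_contra hne
  obtain ⟨n, hn⟩ := ENNReal.exists_inv_nat_lt hne
  have hw' : g w < ((n + 1 : ℕ) : ℝ≥0∞)⁻¹ := Set.mem_iInter.1 hw n
  exact absurd (hw'.trans_le (ENNReal.inv_le_inv.2 (Nat.cast_le.2 n.le_succ))) hn.le.not_gt

end Atoms

/-! ### Approximation and rigidity -/

section Rigidity

variable {p : ℝ} {X : Type*} [MetricSpace X] [MeasurableSpace X] [BorelSpace X]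
  [SecondCountableTopology X]

/-- Markov's inequality bounds the mass moved by at least `δ`; the rest of `F` stays in its
thickening. Applied twice, this lets `eq_of_approx` do without the triangle inequality for `wdist`,
hence without gluing couplings. -/
theorem measure_le_thickening_add (hp0 : 0 < p) (hp1 : p < 1) (μ ν : Space p X) {F : Set X}
    (hF : MeasurableSet F) {δ : ℝ} (hδ : 0 < δ) {r : ℝ≥0∞} (hr : wdist μ ν < r) :
    μ.toMeasure F ≤ ν.toMeasure (Metric.thickening δ F) + r / ENNReal.ofReal δ ^ p := by
  obtain ⟨π, h1, h2, hπ⟩ := exists_coupling_of_wdist_lt hp0 hp1 hr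
  have h0 : ENNReal.ofReal δ ^ p ≠ 0 := by
    simp [ENNReal.rpow_eq_zero_iff_of_pos hp0, hδ]
  have ht : ENNReal.ofReal δ ^ p ≠ ⊤ :=
    ENNReal.rpow_ne_top_of_nonneg hp0.le ENNReal.ofReal_ne_top
  have hmark : π {z | ENNReal.ofReal δ ^ p ≤ cost p z.1 z.2} ≤ r / ENNReal.ofReal δ ^ p := by
    rw [ENNReal.le_div_iff_mul_le (Or.inl h0) (Or.inl ht), mul_comm]
    exact (mul_meas_ge_le_lintegral (measurable_cost measurable_fst measurable_snd) _).trans hπ.le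
  have hT : MeasurableSet (Metric.thickening δ F) := Metric.isOpen_thickening.measurableSet
  calc μ.toMeasure F = π (Prod.fst ⁻¹' F) := by rw [← h1, Measure.fst_apply hF]
    _ ≤ π (Prod.snd ⁻¹' Metric.thickening δ F ∪ {z | ENNReal.ofReal δ ^ p ≤ cost p z.1 z.2}) :=
        measure_mono fun z hz => by
          rcases lt_or_ge (dist z.1 z.2) δ with h | h
          · exact Or.inl (Metric.mem_thickening_iff.2 ⟨z.1, hz, by rwa [dist_comm]⟩)
          · refine Or.inr (ENNReal.rpow_le_rpow ?_ hp0.le)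
            rw [edist_dist]
            exact ENNReal.ofReal_le_ofReal h
    _ ≤ π (Prod.snd ⁻¹' Metric.thickening δ F) + _ := measure_union_le _ _
    _ ≤ _ := by
        rw [← Measure.snd_apply hT, h2]
        gcongr

theorem measure_le_thickening_of_approx (hp0 : 0 < p) (hp1 : p < 1) {μ ν : Space p X}
    (h : ∀ ε : ℝ≥0∞, ε ≠ 0 → ∃ η, wdist μ η < ε ∧ wdist η ν < ε) {F : Set X}
    (hF : MeasurableSet F) {δ : ℝ} (hδ : 0 < δ) :
    μ.toMeasure F ≤ ν.toMeasure (Metric.thickening δ (Metric.thickening δ F)) := by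
  have h0 : ENNReal.ofReal δ ^ p ≠ 0 := by
    simp [ENNReal.rpow_eq_zero_iff_of_pos hp0, hδ]
  have ht : ENNReal.ofReal δ ^ p ≠ ⊤ :=
    ENNReal.rpow_ne_top_of_nonneg hp0.le ENNReal.ofReal_ne_top
  refine ENNReal.le_of_forall_pos_le_add fun ε hε _ => ?_
  have hε' : (ε / 2 : ℝ≥0∞) ≠ 0 := by simp [hε.ne']
  obtain ⟨η, h1, h2⟩ := h (ε / 2 * ENNReal.ofReal δ ^ p) (mul_ne_zero hε' h0)
  have e1 := measure_le_thickening_add hp0 hp1 μ η hF hδ h1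
  have e2 := measure_le_thickening_add hp0 hp1 η ν
    (Metric.isOpen_thickening (δ := δ) (E := F)).measurableSet hδ h2
  rw [ENNReal.mul_div_cancel_right h0 ht] at e1 e2
  refine e1.trans ((add_le_add_left e2 _).trans_eq ?_)
  rw [add_assoc, ENNReal.add_halves]

/-- Two points of the Wasserstein space that are jointly approximable are equal. -/
theorem eq_of_approx (hp0 : 0 < p) (hp1 : p < 1) {μ ν : Space p X}
    (h : ∀ ε : ℝ≥0∞, ε ≠ 0 → ∃ η, wdist μ η < ε ∧ wdist η ν < ε) : μ = ν := by
  have key : ∀ {μ ν : Space p X}, (∀ ε : ℝ≥0∞, ε ≠ 0 → ∃ η, wdist μ η < ε ∧ wdist η ν < ε) →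
      ∀ F : Set X, IsClosed F → μ.toMeasure F ≤ ν.toMeasure F := by
    intro μ ν h F hF
    -- Thickenings of a closed set shrink to the set itself.
    have hlim := tendsto_measure_thickening_of_isClosed (μ := ν.toMeasure)
      ⟨1, one_pos, measure_ne_top _ _⟩ hF
    refine ge_of_tendsto hlim ?_
    filter_upwards [self_mem_nhdsWithin] with δ hδ
    refine (measure_le_thickening_of_approx hp0 hp1 h hF.measurableSet
      (half_pos hδ)).trans (measure_mono ?_)
    exact (Metric.thickening_thickening_subset _ _ _).trans (by rw [add_halves])
  have h' : ∀ ε : ℝ≥0∞, ε ≠ 0 → ∃ η, wdist ν η < ε ∧ wdist η μ < ε := fun ε hε => by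
    obtain ⟨η, h1, h2⟩ := h ε hε
    exact ⟨η, by rwa [wdist_comm hp0 hp1], by rwa [wdist_comm hp0 hp1]⟩
  refine Space.ext_measure (ext_of_generate_finite _ ?_ isPiSystem_isClosed
    (fun F hF => le_antisymm (key h F hF) (key h' F hF)) (by simp))
  rw [BorelSpace.measurable_eq (α := X), borel_eq_generateFrom_isClosed]

theorem exists_countable_wdist_lt (hp0 : 0 < p) (hp1 : p < 1) (μ : Space p X) {ε : ℝ≥0∞}
    (hε : ε ≠ 0) : ∃ ν : Space p X, wdist μ ν < ε ∧
      ∃ S : Set X, S.Countable ∧ ν.toMeasure Sᶜ = 0 := by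
  classical
  obtain ⟨x₀, -⟩ := μ.2
  have : Nonempty X := ⟨x₀⟩
  -- The bound by 1 keeps `r` finite even if `ε = ⊤`.
  obtain ⟨r, hr0, hr⟩ : ∃ r : ℝ≥0∞, 0 < r ∧ r < min ε 1 :=
    exists_between (lt_min (pos_iff_ne_zero.2 hε) one_pos)
  have hex : ∀ x : X, ∃ n, cost p x (TopologicalSpace.denseSeq X n) < r := by
    intro x
    have hs : 0 < r ^ p⁻¹ := ENNReal.rpow_pos hr0 (hr.trans_le (min_le_right _ _)).ne_top
    obtain ⟨_, ⟨n, rfl⟩, hy⟩ := EMetric.mem_closure_iff.1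
      (TopologicalSpace.denseRange_denseSeq X x) _ hs
    exact ⟨n, (ENNReal.lt_rpow_inv_iff hp0).1 hy⟩
  -- Choosing the first close enough point of the dense sequence makes `T` measurable.
  let T : X → X := fun x => TopologicalSpace.denseSeq X (Nat.find (hex x))
  have hT : Measurable T := (measurable_from_nat (f := TopologicalSpace.denseSeq X)).comp
    (measurable_find hex fun n =>
      measurableSet_lt (measurable_cost measurable_id' measurable_const) measurable_const)
  have hle : ∫⁻ z, cost p z (T z) ∂μ.toMeasure ≤ r := by
    refine (lintegral_mono fun z => (Nat.find_spec (hex z)).le).trans ?_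
    simp
  obtain ⟨ν, hν, hd⟩ := exists_eq_map hp0 hp1 μ hT
    (ne_top_of_le_ne_top (hr.trans_le (min_le_right _ _)).ne_top hle)
  refine ⟨ν, (hd.trans hle).trans_lt (hr.trans_le (min_le_left _ _)),
    Set.range (TopologicalSpace.denseSeq X), Set.countable_range _, ?_⟩
  have : T ⁻¹' (Set.range (TopologicalSpace.denseSeq X))ᶜ = ∅ := by
    ext z
    simp [T]
  rw [hν, Measure.map_apply hT (Set.countable_range _).measurableSet.compl, this, measure_empty]

/-- A distance preserving map that fixes all Dirac measures is the identity. -/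
theorem eq_of_fixes_diracSpace (hp0 : 0 < p) (hp1 : p < 1) {Φ : Space p X → Space p X}
    (hΦ : ∀ μ ν, wdist (Φ μ) (Φ ν) = wdist μ ν)
    (hdirac : ∀ x, Φ (diracSpace hp0 x) = diracSpace hp0 x) (μ : Space p X) : Φ μ = μ := by
  have htwo : ∀ {x y : X}, x ≠ y → ∀ η : Space p X, η.toMeasure {x, y}ᶜ = 0 → Φ η = η :=
    fun {x y} hxy η hη => (eq_of_wdist_eq_of_two_points hp0 hp1 hxy hη
      (by rw [← hΦ (diracSpace hp0 x) η, hdirac]) (by rw [← hΦ (diracSpace hp0 y) η, hdirac])).symm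
  have hatom : ∀ (ν : Space p X) (y : X), ν.toMeasure {y} ≤ (Φ ν).toMeasure {y} := by
    intro ν y
    -- The two-point test needs a second point; in a one-point space both masses are 1.
    by_cases h : ∃ x, x ≠ y
    · obtain ⟨x, hxy⟩ := h
      obtain ⟨η, hη, hηy, hle⟩ := exists_two_points_between hp0 hp1 hxy ν
      rw [← hηy] at hle ⊢
      refine singleton_le_of_two_points_between hp0 hp1 hxy hη ?_
      rwa [← hΦ ν η, ← hΦ ν (diracSpace hp0 x), hdirac, htwo hxy η hη] at hle
    · push Not at h
      have : ({y} : Set X) = Set.univ := Set.eq_univ_of_forall h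
      simp [this]
  have hcount : ∀ (ν : Space p X) (S : Set X), S.Countable → ν.toMeasure Sᶜ = 0 → Φ ν = ν :=
    fun ν S hS h0 => Space.ext_measure
      (eq_of_forall_singleton_le hS h0 fun x _ => hatom ν x).symm
  refine eq_of_approx hp0 hp1 fun ε hε => ?_
  obtain ⟨ν, hlt, S, hS, h0⟩ := exists_countable_wdist_lt hp0 hp1 μ hε
  refine ⟨ν, ?_, by rwa [wdist_comm hp0 hp1]⟩
  rwa [← hcount ν S hS h0, hΦ]

/-- The characterisation of Dirac measures uses only distances, so it passes through `Φ` once `α`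
and `β` are pulled back by surjectivity. -/
theorem map_diracSpace [CompleteSpace X] (hp0 : 0 < p) (hp1 : p < 1)
    {Φ : Space p X → Space p X} (hbij : Function.Bijective Φ)
    (hΦ : ∀ μ ν, wdist (Φ μ) (Φ ν) = wdist μ ν) (x : X) :
    ∃ y, Φ (diracSpace hp0 x) = diracSpace hp0 y := by
  refine exists_eq_diracSpace hp0 hp1 fun α β h => ?_
  obtain ⟨α, rfl⟩ := hbij.2 α
  obtain ⟨β, rfl⟩ := hbij.2 β
  rw [hΦ, hΦ, hΦ] at h
  exact (eq_or_eq_diracSpace_of_between hp0 hp1 h).imp (congrArg Φ) (congrArg Φ)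

theorem diracSpace_injective (hp0 : 0 < p) (hp1 : p < 1) :
    Function.Injective (diracSpace hp0 : X → Space p X) := fun x y h => by
  have h' := wdist_diracSpace_diracSpace hp0 hp1 x y
  rw [h, wdist_diracSpace_diracSpace hp0 hp1, cost_self hp0] at h'
  exact (cost_eq_zero hp0).1 h'.symm

theorem exists_isometryEquiv_map_diracSpace [CompleteSpace X] (hp0 : 0 < p) (hp1 : p < 1)
    {Φ : Space p X → Space p X} (hbij : Function.Bijective Φ)
    (hΦ : ∀ μ ν, wdist (Φ μ) (Φ ν) = wdist μ ν) :
    ∃ ψ : X ≃ᵢ X, ∀ x, Φ (diracSpace hp0 x) = diracSpace hp0 (ψ x) := by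
  choose f hf using map_diracSpace hp0 hp1 hbij hΦ
  have hiso : Isometry f := fun x y => by
    have h := hΦ (diracSpace hp0 x) (diracSpace hp0 y)
    rw [hf, hf, wdist_diracSpace_diracSpace hp0 hp1, wdist_diracSpace_diracSpace hp0 hp1] at h
    exact ENNReal.rpow_left_injective hp0.ne' h
  -- The inverse of `Φ` also preserves distances, so it sends the Dirac measure at `y` to a Dirac
  -- measure, whose base point is the preimage.
  have hsurj : Function.Surjective f := fun y => by
    let e := Equiv.ofBijective Φ hbij
    have he : ∀ μ ν, wdist (e.symm μ) (e.symm ν) = wdist μ ν := fun μ ν => by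
      rw [← hΦ]
      exact congrArg₂ wdist (e.apply_symm_apply μ) (e.apply_symm_apply ν)
    obtain ⟨x, hx⟩ := map_diracSpace hp0 hp1 e.symm.bijective he y
    refine ⟨x, diracSpace_injective hp0 hp1 ?_⟩
    rw [← hf, ← hx]
    exact e.apply_symm_apply _
  exact ⟨⟨Equiv.ofBijective f ⟨hiso.injective, hsurj⟩, hiso⟩, hf⟩

theorem pushSpace_diracSpace (hp0 : 0 < p) (ψ : X ≃ᵢ X) (x : X) :
    pushSpace ψ (diracSpace hp0 x) = diracSpace hp0 (ψ x) := by
  apply Space.ext_measure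
  rw [toMeasure_pushSpace, toMeasure_diracSpace, toMeasure_diracSpace,
    Measure.map_dirac' ψ.continuous.measurable]

theorem exists_eq_pushSpace [CompleteSpace X] (hp0 : 0 < p) (hp1 : p < 1)
    {Φ : Space p X → Space p X} (hbij : Function.Bijective Φ)
    (hΦ : ∀ μ ν, wdist (Φ μ) (Φ ν) = wdist μ ν) :
    ∃ ψ : X ≃ᵢ X, ∀ μ, Φ μ = pushSpace ψ μ := by
  obtain ⟨ψ, hψ⟩ := exists_isometryEquiv_map_diracSpace hp0 hp1 hbij hΦ
  refine ⟨ψ, fun μ => ?_⟩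
  have h := eq_of_fixes_diracSpace hp0 hp1 (Φ := fun μ => pushSpace ψ.symm (Φ μ))
    (fun μ ν => by rw [wdist_pushSpace hp0, hΦ])
    (fun x => by simp only [hψ, pushSpace_diracSpace, ψ.symm_apply_apply]) μ
  have h' : pushSpace ψ (pushSpace ψ.symm (Φ μ)) = Φ μ := pushSpace_symm_pushSpace ψ.symm (Φ μ)
  rw [← h']
  exact congrArg (pushSpace ψ) h

end Rigidity

end Wasserstein

theorem mainTheorem5 (X : Type*) [MetricSpace X] [CompleteSpace X]
    [TopologicalSpace.SeparableSpace X] [MeasurableSpace X] [BorelSpace X]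
    (p : ℝ) (hp0 : 0 < p) (hp1 : p < 1) :
    Wasserstein.IsometricallyRigid p hp0 X ∧
      ∀ Φ : Wasserstein.Space p X → Wasserstein.Space p X, Function.Bijective Φ →
        (∀ μ ν, Wasserstein.wdist (Φ μ) (Φ ν) = Wasserstein.wdist μ ν) →
        ∃ ψ : X ≃ᵢ X, ∀ μ : Wasserstein.Space p X,
          (Φ μ).toMeasure = μ.toMeasure.map ψ := by
  have : SecondCountableTopology X := UniformSpace.secondCountable_of_separable X
  constructor
  · rintro ⟨e, he⟩
    obtain ⟨ψ, hψ⟩ := Wasserstein.exists_eq_pushSpace hp0 hp1 e.bijective he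
    refine ⟨ψ, ?_⟩
    have : (Wasserstein.push hp0 ψ).toEquiv = e := Equiv.ext fun μ => (hψ μ).symm
    cases this
    rfl
  · intro Φ hbij hΦ
    obtain ⟨ψ, hψ⟩ := Wasserstein.exists_eq_pushSpace hp0 hp1 hbij hΦ
    exact ⟨ψ, fun μ => by rw [hψ, Wasserstein.toMeasure_pushSpace]⟩
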